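/- Let $a\in\mathbb{C}$ with $|a|<1$, write $a=|a|e^{it_a}$, and let $\theta_a:\mathbb{R}\to\mathbb{R}$ be the continuous phase function with $$e^{i\theta_a(t)}=\frac{e^{it}-a}{1-\overline{a}e^{it}},\qquad \theta_a'(t)=p_a(t)=\frac{1-|a|^2}{1-2|a|\cos(t-t_a)+|a|^2}.$$ For $1\le p<\infty$ let $L^p(\mathbb{T})$ be the space of complex-valued functions on $\mathbb{T}=\mathbb{R}/2\pi\mathbb{Z}$ with norm $\|f\|_p=\left(\frac1{2\pi}\int_{-\pi}^{\pi}|f(x)|^p\,dx\right)^{1/p}$, and for $f\in L^1(\mathbb{T})$ and $n=0,1,2,\dots$ put $$S_n^a(f)(x)=\sum_{k=-n}^{n}c_k(f)\,e^{ik\theta_a(x)},\qquad c_k(f)=\frac1{2\pi}\int_{-\pi}^{\pi}f(t)\,e^{-ik\theta_a(t)}\,p_a(t)\,dt .$$ Corollary 2.1. Let $1<p<\infty$. Then every $S_n^a$ is a bounded linear operator on $L^p(\mathbb{T})$, and the operator norms are uniformly bounded: there is a constant $M=M_p^a>0$, depending only on $p$ and $a$, such that $\|S_n^a(f)\|_p\le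 M\|f\|_p$ for all $n\ge 0$ and all $f\in L^p(\mathbb{T})$. Consequently, $\|f-S_n^a(f)\|_p\to 0$ as $n\to\infty$ for every $f\in L^p(\mathbb{T})$. -/

import Mathlib

open MeasureTheory Filter Topology
open scoped ENNReal

noncomputable section

namespace NonlinearFourier

/-- The Möbius transformation `τ_a(z) = (z - a) / (1 - conj a * z)`. -/
def mobius (a z : ℂ) : ℂ := (z - a) / (1 - (starRingEnd ℂ) a * z)

/-- The nonlinear phase function `θ_a`, for `|a| < 1`: the continuous real function with
`exp (i θ_a(t)) = τ_a(exp (i t))`. Since `τ_a(e^{it}) = e^{it} w / conj w` with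
`w = 1 - a e^{-it}` and `Re w > 0`, it is given by `θ_a(t) = t + 2 arg w`. -/
def phase (a : ℂ) (t : ℝ) : ℝ :=
  t + 2 * Complex.arg (1 - a * Complex.exp (-(t * Complex.I)))

/-- The Poisson kernel `p_a(t) = (1 - |a|²) / (1 - 2 |a| cos (t - t_a) + |a|²)`, where
`a = |a| e^{i t_a}`. -/
def poisson (a : ℂ) (t : ℝ) : ℝ :=
  (1 - ‖a‖ ^ 2) / (1 - 2 * ‖a‖ * Real.cos (t - Complex.arg a) + ‖a‖ ^ 2)

/-- Normalized Lebesgue measure `dx / (2π)` on the circle `𝕋`, parametrized by `(-π, π]`. -/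
def circleMeasure : Measure ℝ :=
  ENNReal.ofReal (1 / (2 * Real.pi)) • volume.restrict (Set.Ioc (-Real.pi) Real.pi)

/-- The nonlinear Fourier coefficient
`c_k(f) = (1 / 2π) ∫_{-π}^{π} f(t) e^{-i k θ_a(t)} p_a(t) dt`. -/
def coeff (a : ℂ) (f : ℝ → ℂ) (k : ℤ) : ℂ :=
  (1 / (2 * (Real.pi : ℂ))) * ∫ t in (-Real.pi)..Real.pi,
    f t * Complex.exp (-(Complex.I * k * phase a t)) * poisson a t

/-- The partial sum `S_n^a(f)(x) = ∑_{k=-n}^{n} c_k(f) e^{i k θ_a(x)}`. -/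
def partialSum (a : ℂ) (n : ℕ) (f : ℝ → ℂ) (x : ℝ) : ℂ :=
  ∑ k ∈ Finset.Icc (-(n : ℤ)) n, coeff a f k * Complex.exp (Complex.I * k * phase a x)

theorem norm_mul_exp_neg (a : ℂ) (t : ℝ) : ‖a * Complex.exp (-(t * Complex.I))‖ = ‖a‖ := by
  have h : -((t : ℂ) * Complex.I) = ((-t : ℝ) : ℂ) * Complex.I := by push_cast; ring
  rw [norm_mul, h, Complex.norm_exp_ofReal_mul_I, mul_one]

theorem re_pos {a : ℂ} (ha : ‖a‖ < 1) (t : ℝ) :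
    0 < (1 - a * Complex.exp (-(t * Complex.I))).re := by
  have h := Complex.re_le_norm (a * Complex.exp (-(t * Complex.I)))
  rw [norm_mul_exp_neg] at h
  rw [Complex.sub_re, Complex.one_re]
  linarith

/-- The defining relation of the phase function. -/
theorem exp_phase {a : ℂ} (ha : ‖a‖ < 1) (t : ℝ) :
    Complex.exp (Complex.I * phase a t) = mobius a (Complex.exp (t * Complex.I)) := by
  have hre := re_pos ha t
  have hwdef : ∃ w, w = 1 - a * Complex.exp (-(t * Complex.I)) := ⟨_, rfl⟩
  obtain ⟨w, hw⟩ := hwdef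
  rw [← hw] at hre
  have hw0 : w ≠ 0 := by rintro rfl; simp at hre
  have hc0 : (starRingEnd ℂ) w ≠ 0 := by simpa using hw0
  have hE : Complex.exp (-(t * Complex.I)) * Complex.exp (t * Complex.I) = 1 := by
    rw [← Complex.exp_add]; simp
  have hcw : (starRingEnd ℂ) w = 1 - (starRingEnd ℂ) a * Complex.exp (t * Complex.I) := by
    rw [hw, map_sub, map_one, map_mul, ← Complex.exp_conj]
    simp
  have h1 : (‖w‖ : ℂ) * Complex.exp (w.arg * Complex.I) = w := Complex.norm_mul_exp_arg_mul_I w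
  have h2 : w * (starRingEnd ℂ) w = (‖w‖ : ℂ) ^ 2 := Complex.mul_conj' w
  have hn : (‖w‖ : ℂ) ≠ 0 := by simpa using hw0
  have h3 : Complex.exp (w.arg * Complex.I) ^ 2 * (starRingEnd ℂ) w = w := by
    apply mul_left_cancel₀ (mul_ne_zero hn hn)
    calc (‖w‖ : ℂ) * ‖w‖ * (Complex.exp (w.arg * Complex.I) ^ 2 * (starRingEnd ℂ) w)
        = ((‖w‖ : ℂ) * Complex.exp (w.arg * Complex.I)) ^ 2 * (starRingEnd ℂ) w := by ring
      _ = w * (w * (starRingEnd ℂ) w) := by rw [h1]; ring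
      _ = (‖w‖ : ℂ) * ‖w‖ * w := by rw [h2]; ring
  have h4 : Complex.exp (Complex.I * phase a t)
      = Complex.exp (t * Complex.I) * Complex.exp (w.arg * Complex.I) ^ 2 := by
    rw [← Complex.exp_nat_mul, ← Complex.exp_add, phase, ← hw]
    congr 1
    push_cast
    ring
  rw [mobius, h4, ← hcw, eq_div_iff hc0, mul_assoc, h3, hw]
  linear_combination (-a) * hE

/-- The Poisson kernel is the derivative of the phase function. -/
theorem hasDerivAt_phase {a : ℂ} (ha : ‖a‖ < 1) (t : ℝ) :
    HasDerivAt (phase a) (poisson a t) t := by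
  have hre := re_pos ha t
  have h0 : HasDerivAt (fun s : ℝ => -((s : ℂ) * Complex.I)) (-(1 * Complex.I)) t :=
    ((Complex.ofRealCLM.hasDerivAt (x := t)).mul_const Complex.I).neg
  have h1 : HasDerivAt (fun s : ℝ => 1 - a * Complex.exp (-(s * Complex.I)))
      (-(a * (Complex.exp (-(t * Complex.I)) * -(1 * Complex.I)))) t :=
    (h0.cexp.const_mul a).const_sub 1
  have h2 := h1.clog_real (Complex.mem_slitPlane_iff.2 (Or.inl hre))
  have h3 := (hasDerivAt_id t).add ((Complex.imCLM.hasFDerivAt.comp_hasDerivAt t h2).const_mul 2)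
  have hz := norm_mul_exp_neg a t
  have hzc : a * Complex.exp (-(t * Complex.I))
      = ((‖a‖ * Real.cos (t - a.arg) : ℝ) : ℂ)
        - ((‖a‖ * Real.sin (t - a.arg) : ℝ) : ℂ) * Complex.I := by
    conv_lhs => rw [← Complex.norm_mul_exp_arg_mul_I a]
    rw [mul_assoc, ← Complex.exp_add]
    have : (a.arg : ℂ) * Complex.I + -(t * Complex.I) = ((a.arg - t : ℝ) : ℂ) * Complex.I := by
      push_cast; ring
    rw [this, Complex.exp_mul_I, ← Complex.ofReal_cos, ← Complex.ofReal_sin,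
      ← neg_sub t a.arg, Real.cos_neg, Real.sin_neg]
    push_cast
    ring
  refine (h3.congr_deriv ?_).congr_of_eventuallyEq (Eventually.of_forall fun s => ?_)
  · have e : -(a * (Complex.exp (-(t * Complex.I)) * -(1 * Complex.I)))
        = (a * Complex.exp (-(t * Complex.I))) * Complex.I := by ring
    have hpos : 0 < 1 - 2 * ‖a‖ * Real.cos (t - a.arg) + ‖a‖ ^ 2 := by
      nlinarith [Real.cos_le_one (t - a.arg), norm_nonneg a, sq_pos_of_pos (sub_pos.2 ha)]
    rw [Complex.imCLM_apply, e, hzc, poisson, Complex.div_im]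
    have hs : Complex.normSq (1 - (((‖a‖ * Real.cos (t - a.arg) : ℝ) : ℂ)
        - ((‖a‖ * Real.sin (t - a.arg) : ℝ) : ℂ) * Complex.I))
        = 1 - 2 * ‖a‖ * Real.cos (t - a.arg) + ‖a‖ ^ 2 := by
      rw [Complex.normSq_apply]
      simp only [Complex.sub_re, Complex.sub_im, Complex.one_re, Complex.one_im,
        Complex.re_ofReal_mul, Complex.im_ofReal_mul, Complex.ofReal_re, Complex.ofReal_im,
        Complex.I_re, Complex.I_im]
      linear_combination ‖a‖ ^ 2 * Real.sin_sq_add_cos_sq (t - a.arg)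
    rw [hs]
    simp only [Complex.sub_re, Complex.sub_im, Complex.one_re, Complex.one_im, Complex.mul_re,
      Complex.mul_im, Complex.ofReal_re, Complex.ofReal_im, Complex.I_re, Complex.I_im]
    field_simp
    linear_combination (-2 * ‖a‖ ^ 2) * Real.sin_sq_add_cos_sq (t - a.arg)
  · simp [phase, Complex.log_im]

end NonlinearFourier

end

/-!
The operators `S_n^a` are the partial sums of ordinary Fourier series, transplanted by the phase
`θ_a`. On the circle `θ_a` is the boundary map of a Möbius transformation of the disc, so it is a
bijection (with inverse the phase of `τ_{-a}`, `mobius_neg_mobius`) which carries `p_a(t) dt / 2π`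
to Haar measure (`map_phaseCircle`). Hence `c_k(f)` is the `k`-th Fourier coefficient of
`f ∘ θ_a⁻¹` (`fourierCoeff_comp_phaseCircleInv`), and since `p_a` is bounded above and below, both
compositions, with `θ_a` and with its inverse, are bounded on `L^p`. The claim is thereby reduced to
the theorem of M. Riesz on the uniform boundedness of partial sums of Fourier series
(`exists_norm_fourierSumCLM_le`); convergence follows from boundedness, because it is trivial for
trigonometric polynomials, which are dense (`tendsto_fourierSumCLM`).

For `1 < p ≤ 2` Riesz's theorem rests on the inequality `|z|^p ≤ A (Re z)^p - B Re (z^p)` in the right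
half-plane. If `f` is a positive trigonometric polynomial and `F` the analytic polynomial with
`Re F = f` on the circle and `F(0)` real, then `F` maps the disc into the right half-plane, `F^p` is
holomorphic, and the mean value property yields `∫ |F|^p ≤ A ∫ f^p` since `Re F(0)^p ≥ 0`
(`exists_integral_norm_rpow_le_integral_re_rpow`). This bounds the projection onto the nonnegative
frequencies for positive trigonometric polynomials, then for nonnegative continuous functions by
approximation with `|q|² + δ`, where Bessel's inequality controls the error, and finally for all
continuous functions by splitting them into four nonnegative parts. A symmetric partial sum is a
difference of two modulated projections (`fourierSum_Icc_eq_sub`). The range `p ≥ 2` follows by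
duality (`norm_fourierSum_le_of_conjugate`), so that no interpolation is needed.
-/

namespace NonlinearFourier

/-! ### An inequality for powers in the right half-plane -/

/-- The restriction `1 < p ≤ 2` makes `cos (p * θ)` negative at `θ = ±π/2`, where `cos θ ^ p`
vanishes. -/
theorem exists_one_le_cos_rpow_sub_cos {p : ℝ} (hp1 : 1 < p) (hp2 : p ≤ 2) :
    ∃ A B : ℝ, 0 ≤ A ∧ 0 ≤ B ∧ ∀ θ : ℝ, |θ| ≤ Real.pi / 2 →
      1 ≤ A * Real.cos θ ^ p - B * Real.cos (θ * p) := by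
  have hpi := Real.pi_pos
  -- beyond `θ₀` the angle `p * θ` lies in `(π/2, π]`, where the cosine is negative
  obtain ⟨θ₀, h1, h2⟩ : ∃ θ₀, Real.pi / (2 * p) < θ₀ ∧ θ₀ < Real.pi / 2 := by
    apply exists_between
    apply div_lt_div_of_pos_left hpi <;> linarith
  have h0 : 0 < θ₀ := lt_trans (by positivity) h1
  have hθp : Real.pi / 2 < θ₀ * p := by
    rw [div_lt_iff₀ (by positivity)] at h1
    linarith
  have hθp' : θ₀ * p ≤ Real.pi := by nlinarith
  have hneg : Real.cos (θ₀ * p) < 0 :=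
    Real.cos_neg_of_pi_div_two_lt_of_lt hθp (by linarith)
  have hpos : 0 < Real.cos θ₀ := Real.cos_pos_of_mem_Ioo ⟨by linarith, h2⟩
  have hB : 0 < -(1 / Real.cos (θ₀ * p)) := by
    rw [neg_pos, one_div]; exact inv_lt_zero.2 hneg
  have hA : 0 < Real.cos θ₀ ^ p := Real.rpow_pos_of_pos hpos p
  refine ⟨(1 + -(1 / Real.cos (θ₀ * p))) / Real.cos θ₀ ^ p, -(1 / Real.cos (θ₀ * p)),
    by positivity, hB.le, fun θ hθ => ?_⟩
  have hcos : Real.cos θ = Real.cos |θ| := (Real.cos_abs θ).symm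
  have hcosp : Real.cos (θ * p) = Real.cos (|θ| * p) := by
    rw [← Real.cos_abs (θ * p), abs_mul, abs_of_pos (by linarith : 0 < p)]
  rw [hcos, hcosp]
  have hc0 : 0 ≤ Real.cos |θ| :=
    Real.cos_nonneg_of_neg_pi_div_two_le_of_le (by linarith [abs_nonneg θ]) hθ
  rcases le_total θ₀ |θ| with h | h
  · have hle : Real.cos (|θ| * p) ≤ Real.cos (θ₀ * p) := by
      apply Real.cos_le_cos_of_nonneg_of_le_pi (by positivity)
      · nlinarith
      · gcongr
    have h3 : 1 ≤ (1 / Real.cos (θ₀ * p)) * Real.cos (|θ| * p) := by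
      rw [one_div, mul_comm, ← div_eq_mul_inv]
      exact (one_le_div_of_neg hneg).2 hle
    have h4 : 0 ≤ (1 + -(1 / Real.cos (θ₀ * p))) / Real.cos θ₀ ^ p * Real.cos |θ| ^ p := by
      positivity
    linarith
  · have h3 : Real.cos θ₀ ^ p ≤ Real.cos |θ| ^ p := by
      apply Real.rpow_le_rpow hpos.le _ (by linarith)
      exact Real.cos_le_cos_of_nonneg_of_le_pi (abs_nonneg θ) (by linarith) h
    have h4 : 1 + -(1 / Real.cos (θ₀ * p))
        ≤ (1 + -(1 / Real.cos (θ₀ * p))) / Real.cos θ₀ ^ p * Real.cos |θ| ^ p := by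
      rw [div_mul_eq_mul_div, le_div_iff₀ hA]
      gcongr
    have h5 := mul_le_mul_of_nonneg_left (Real.cos_le_one (|θ| * p)) hB.le
    linarith

theorem exists_norm_rpow_le_re_rpow_sub_re_cpow {p : ℝ} (hp1 : 1 < p) (hp2 : p ≤ 2) :
    ∃ A B : ℝ, 0 ≤ A ∧ 0 ≤ B ∧ ∀ z : ℂ, 0 < z.re →
      ‖z‖ ^ p ≤ A * z.re ^ p - B * (z ^ (p : ℂ)).re := by
  obtain ⟨A, B, hA, hB, h⟩ := exists_one_le_cos_rpow_sub_cos hp1 hp2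
  refine ⟨A, B, hA, hB, fun z hz => ?_⟩
  have h1 := h z.arg (Complex.abs_arg_le_pi_div_two_iff.2 hz.le)
  have hz0 : z ≠ 0 := by rintro rfl; simp at hz
  have hcos : 0 ≤ Real.cos z.arg := by
    rw [Complex.cos_arg hz0]; positivity
  have hre : z.re = ‖z‖ * Real.cos z.arg := (Complex.norm_mul_cos_arg z).symm
  rw [Complex.cpow_ofReal_re, hre, Real.mul_rpow (norm_nonneg z) hcos]
  have := mul_le_mul_of_nonneg_left h1 (Real.rpow_nonneg (norm_nonneg z) p)
  linarith

/-! ### Holomorphic functions with positive real part -/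

/-- The minimum principle for the real part of a holomorphic function. -/
theorem le_re_of_le_re_on_sphere {F : ℂ → ℂ} (hF : DiffContOnCl ℂ F (Metric.ball 0 1)) {ε : ℝ}
    (h : ∀ z ∈ Metric.sphere (0 : ℂ) 1, ε ≤ (F z).re) {z : ℂ} (hz : z ∈ Metric.closedBall 0 1) :
    ε ≤ (F z).re := by
  -- the maximum modulus principle for `exp (-F)`
  have hd : DiffContOnCl ℂ (fun z => Complex.exp (-F z)) (Metric.ball 0 1) :=
    Complex.differentiable_exp.comp_diffContOnCl hF.neg
  have key := Complex.norm_le_of_forall_mem_frontier_norm_le Metric.isBounded_ball hd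
    (C := Real.exp (-ε)) (fun w hw => ?_) (z := z) ?_
  · simpa [Complex.norm_exp] using key
  · rw [frontier_ball _ one_ne_zero] at hw
    simpa [Complex.norm_exp] using h w hw
  · rwa [closure_ball _ one_ne_zero]

theorem fourier_one_mem_sphere {T : ℝ} (x : AddCircle T) : (fourier 1 x : ℂ) ∈ Metric.sphere (0 : ℂ) 1 := by
  simpa only [fourier_apply, mem_sphere_zero_iff_norm] using Circle.norm_coe _

variable {T : ℝ} [hT : Fact (0 < T)]

open AddCircle

/-- The mean value property, with the unit circle parametrized by `AddCircle T` through
`fourier 1`. -/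
theorem integral_comp_fourier_one {G : ℂ → ℂ} (hG : DiffContOnCl ℂ G (Metric.ball 0 1)) :
    ∫ x : AddCircle T, G (fourier 1 x) ∂haarAddCircle = G 0 := by
  have hT0 : T ≠ 0 := hT.out.ne'
  have hav : Real.circleAverage G 0 1 = G 0 := by
    have := DiffContOnCl.circleAverage (f := G) (c := 0) (R := 1) (by simpa using hG)
    exact this
  rw [← hav, Real.circleAverage_def, integral_haarAddCircle,
    ← AddCircle.intervalIntegral_preimage T 0, zero_add]
  have h : ∀ x : ℝ, G (fourier 1 (x : AddCircle T)) = G (circleMap 0 1 (2 * Real.pi / T * x)) := by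
    intro x
    rw [fourier_coe_apply, circleMap]
    congr 1
    push_cast
    rw [zero_add, one_mul]
    congr 1
    ring
  simp_rw [h]
  rw [intervalIntegral.integral_comp_mul_left (fun x => G (circleMap 0 1 x))
    (by have := Real.pi_pos; positivity), smul_smul]
  congr 1
  · field_simp
  · rw [mul_zero, div_mul_cancel₀ _ hT0]

/-- A holomorphic function with positive real part which is real at the origin is bounded in `L^p` of
the circle by its real part. -/
theorem exists_integral_norm_rpow_le_integral_re_rpow (T : ℝ) [hT : Fact (0 < T)] {p : ℝ}
    (hp1 : 1 < p) (hp2 : p ≤ 2) :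
    ∃ A : ℝ, 0 ≤ A ∧ ∀ F : ℂ → ℂ, DiffContOnCl ℂ F (Metric.ball 0 1) → (F 0).im = 0 →
      ∀ ε : ℝ, 0 < ε → (∀ z ∈ Metric.sphere (0 : ℂ) 1, ε ≤ (F z).re) →
      ∫ x : AddCircle T, ‖F (fourier 1 x)‖ ^ p ∂haarAddCircle
        ≤ A * ∫ x : AddCircle T, (F (fourier 1 x)).re ^ p ∂haarAddCircle := by
  obtain ⟨A, B, hA, hB, hAB⟩ := exists_norm_rpow_le_re_rpow_sub_re_cpow hp1 hp2
  refine ⟨A, hA, fun F hF him ε hε hre => ?_⟩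
  have hp0 : 0 ≤ p := by linarith
  have hpos : ∀ z ∈ Metric.closedBall (0 : ℂ) 1, 0 < (F z).re := fun z hz =>
    hε.trans_le (le_re_of_le_re_on_sphere hF hre hz)
  have hcl : closure (Metric.ball (0 : ℂ) 1) = Metric.closedBall 0 1 := closure_ball _ one_ne_zero
  have hG : DiffContOnCl ℂ (fun z => F z ^ (p : ℂ)) (Metric.ball 0 1) := by
    refine ⟨fun z hz => ?_, ?_⟩
    · exact ((hF.1 z hz).cpow_const (Or.inl (hpos z (Metric.ball_subset_closedBall hz))))
    · rw [hcl]
      exact ContinuousOn.cpow_const (hcl ▸ hF.2) fun z hz => Or.inl (hpos z hz)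
  have hcont : ∀ H : ℂ → ℂ, DiffContOnCl ℂ H (Metric.ball 0 1) →
      Continuous fun x : AddCircle T => H (fourier 1 x) := by
    intro H hH
    refine ContinuousOn.comp_continuous (s := Metric.closedBall 0 1) (hcl ▸ hH.2)
      (map_continuous (fourier 1)) fun x => ?_
    exact Metric.sphere_subset_closedBall (fourier_one_mem_sphere x)
  have hint : ∀ g : AddCircle T → ℝ, Continuous g → Integrable g haarAddCircle := fun g hg =>
    hg.integrable_of_hasCompactSupport (HasCompactSupport.of_compactSpace g)
  have hcF := hcont F hF
  have hcG := hcont _ hG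
  have i1 := hint _ (hcF.norm.rpow_const fun _ => Or.inr hp0)
  have i2 := hint _ ((Complex.continuous_re.comp hcF).rpow_const fun _ => Or.inr hp0)
  have i3 := hint _ (Complex.continuous_re.comp hcG)
  have hmean : ∫ x : AddCircle T, (F (fourier 1 x) ^ (p : ℂ)).re ∂haarAddCircle
      = (F 0 ^ (p : ℂ)).re := by
    rw [← integral_comp_fourier_one (T := T) hG]
    exact integral_re (𝕜 := ℂ)
      (hcG.integrable_of_hasCompactSupport (HasCompactSupport.of_compactSpace _))
  -- `F 0` is a positive real number, and so is its `p`-th power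
  have h0 : 0 ≤ (F 0 ^ (p : ℂ)).re := by
    have : F 0 = ((F 0).re : ℂ) := Complex.ext rfl (by simpa using him)
    rw [this, ← Complex.ofReal_cpow (hpos 0 (by simp)).le, Complex.ofReal_re]
    exact Real.rpow_nonneg (hpos 0 (by simp)).le p
  calc ∫ x : AddCircle T, ‖F (fourier 1 x)‖ ^ p ∂haarAddCircle
      ≤ ∫ x : AddCircle T, (A * (F (fourier 1 x)).re ^ p - B * (F (fourier 1 x) ^ (p : ℂ)).re)
          ∂haarAddCircle := by
        refine integral_mono i1 ((i2.const_mul A).sub (i3.const_mul B)) fun x => ?_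
        exact hAB _ (hpos _ (Metric.sphere_subset_closedBall (fourier_one_mem_sphere x)))
    _ = A * ∫ x : AddCircle T, (F (fourier 1 x)).re ^ p ∂haarAddCircle
          - B * (F 0 ^ (p : ℂ)).re := by
        rw [← hmean, ← integral_const_mul, ← integral_const_mul]
        exact integral_sub (i2.const_mul A) (i3.const_mul B)
    _ ≤ _ := by linarith [mul_nonneg hB h0]

/-! ### Partial Fourier sums on the circle -/

/-- The partial sum of the Fourier series of `f` over a finite set `s` of frequencies, as a
continuous function on the circle. -/
noncomputable def fourierSum (s : Finset ℤ) (f : AddCircle T → ℂ) : C(AddCircle T, ℂ) :=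
  ∑ k ∈ s, fourierCoeff f k • fourier k

theorem fourierSum_apply (s : Finset ℤ) (f : AddCircle T → ℂ) (x : AddCircle T) :
    fourierSum s f x = ∑ k ∈ s, fourierCoeff f k * fourier k x := by
  simp [fourierSum, -fourier_apply]

theorem integrable_continuousMap (f : C(AddCircle T, ℂ)) : Integrable f haarAddCircle :=
  f.continuous.integrable_of_hasCompactSupport (HasCompactSupport.of_compactSpace _)

theorem fourierCoeff_fourier_apply (j k : ℤ) :
    fourierCoeff (T := T) (fourier j) k = if k = j then 1 else 0 := by
  rw [fourierCoeff_fourier, Pi.single_apply]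

theorem fourierSum_add (s : Finset ℤ) (f g : C(AddCircle T, ℂ)) :
    fourierSum s (f + g : C(AddCircle T, ℂ)) = fourierSum s f + fourierSum s g := by
  simp only [fourierSum, ContinuousMap.coe_add,
    fourierCoeff.add (integrable_continuousMap f) (integrable_continuousMap g), Pi.add_apply,
    add_smul, Finset.sum_add_distrib]

theorem fourierSum_smul (s : Finset ℤ) (c : ℂ) (f : C(AddCircle T, ℂ)) :
    fourierSum s (c • f : C(AddCircle T, ℂ)) = c • fourierSum s f := by
  simp only [fourierSum, ContinuousMap.coe_smul, Finset.smul_sum, fourierCoeff.const_smul,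
    smul_assoc]

theorem fourierSum_sub (s : Finset ℤ) (f g : C(AddCircle T, ℂ)) :
    fourierSum s (f - g : C(AddCircle T, ℂ)) = fourierSum s f - fourierSum s g := by
  rw [eq_sub_iff_add_eq, ← fourierSum_add, sub_add_cancel]

theorem fourierCoeff_conj (f : AddCircle T → ℂ) (k : ℤ) :
    fourierCoeff (fun x => (starRingEnd ℂ) (f x)) (-k) = (starRingEnd ℂ) (fourierCoeff f k) := by
  rw [fourierCoeff, fourierCoeff, ← integral_conj]
  refine integral_congr_ae (Eventually.of_forall fun x => ?_)
  simp only [smul_eq_mul, map_mul, fourier_neg (n := k), fourier_neg (n := -k), Complex.conj_conj]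

theorem fourierCoeff_fourier_mul (j k : ℤ) (f : C(AddCircle T, ℂ)) :
    fourierCoeff (fourier j * f : C(AddCircle T, ℂ)) k = fourierCoeff f (k - j) := by
  rw [fourierCoeff, fourierCoeff]
  refine integral_congr_ae (Eventually.of_forall fun x => ?_)
  simp only [smul_eq_mul, ContinuousMap.mul_apply]
  rw [← mul_assoc, ← fourier_add, show -k + j = -(k - j) by ring]

theorem fourier_mul_fourierSum_Icc (j a b : ℤ) (f : C(AddCircle T, ℂ)) :
    fourier j * fourierSum (Finset.Icc a b) (fourier (-j) * f : C(AddCircle T, ℂ))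
      = fourierSum (Finset.Icc (a + j) (b + j)) f := by
  ext x
  rw [ContinuousMap.mul_apply, fourierSum_apply, fourierSum_apply, Finset.mul_sum,
    ← Finset.map_add_right_Icc, Finset.sum_map]
  refine Finset.sum_congr rfl fun k _ => ?_
  rw [fourierCoeff_fourier_mul, addRightEmbedding_apply, fourier_add, sub_neg_eq_add]
  ring

/-- A trigonometric polynomial equals its partial Fourier sums of sufficiently high degree. -/
theorem eventually_fourierSum_eq {f : C(AddCircle T, ℂ)}
    (hf : f ∈ Submodule.span ℂ (Set.range (@fourier T))) :
    ∀ᶠ n : ℕ in atTop, fourierSum (Finset.Icc (-(n : ℤ)) n) f = f := by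
  induction hf using Submodule.span_induction with
  | mem f hf =>
    obtain ⟨j, rfl⟩ := hf
    filter_upwards [eventually_ge_atTop j.natAbs] with n hn
    ext x
    rw [fourierSum_apply]
    simp only [fourierCoeff_fourier_apply, ite_mul, one_mul, zero_mul]
    rw [Finset.sum_ite_eq', if_pos (by rw [Finset.mem_Icc]; omega)]
  | zero => exact Eventually.of_forall fun n => by simpa using fourierSum_smul _ 0 (0 : C(AddCircle T, ℂ))
  | add f g _ _ hf hg =>
    filter_upwards [hf, hg] with n h1 h2
    rw [fourierSum_add, h1, h2]
  | smul c f _ hf =>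
    filter_upwards [hf] with n h1
    rw [fourierSum_smul, h1]

theorem integral_fourierSum_mul (s : Finset ℤ) (f : AddCircle T → ℂ) (g : C(AddCircle T, ℂ)) :
    ∫ x, fourierSum s f x * g x ∂haarAddCircle
      = ∑ k ∈ s, fourierCoeff f k * fourierCoeff g (-k) := by
  simp only [fourierSum_apply, Finset.sum_mul]
  rw [integral_finsetSum]
  · refine Finset.sum_congr rfl fun k _ => ?_
    simp only [mul_assoc]
    rw [integral_const_mul, fourierCoeff.eq_def g, neg_neg]
    simp only [smul_eq_mul]
  · intro k _
    exact (integrable_continuousMap ((fourierCoeff f k • fourier k) * g)).congr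
      (Eventually.of_forall fun x => by
        simp only [ContinuousMap.mul_apply, ContinuousMap.smul_apply, smul_eq_mul])

/-- The symmetric partial sums are self-transpose with respect to the bilinear integral pairing. -/
theorem integral_fourierSum_mul_comm (m : ℕ) (f g : C(AddCircle T, ℂ)) :
    ∫ x, fourierSum (Finset.Icc (-(m : ℤ)) m) f x * g x ∂haarAddCircle
      = ∫ x, f x * fourierSum (Finset.Icc (-(m : ℤ)) m) g x ∂haarAddCircle := by
  simp only [mul_comm (f _)]
  rw [integral_fourierSum_mul, integral_fourierSum_mul]
  refine Finset.sum_nbij' (fun k => -k) (fun k => -k) ?_ ?_ ?_ ?_ ?_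
  · intro k hk; rw [Finset.mem_Icc] at hk ⊢; omega
  · intro k hk; rw [Finset.mem_Icc] at hk ⊢; omega
  · simp
  · simp
  · intro k _; rw [neg_neg, mul_comm]

/-! ### The `L^p` norm of a continuous function -/

/-- The inclusion of the continuous functions on the circle into `L^p`. -/
noncomputable abbrev contLp (p : ℝ≥0∞) [Fact (1 ≤ p)] :
    C(AddCircle T, ℂ) →L[ℂ] Lp ℂ p (@haarAddCircle T hT) :=
  ContinuousMap.toLp p haarAddCircle ℂ

variable {p : ℝ≥0∞} [Fact (1 ≤ p)]

theorem norm_contLp_eq_eLpNorm (f : C(AddCircle T, ℂ)) :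
    ‖contLp p f‖ = (eLpNorm f p haarAddCircle).toReal := by
  rw [Lp.norm_def, eLpNorm_congr_ae (ContinuousMap.coeFn_toLp haarAddCircle f)]

theorem norm_contLp_rpow (hp : p ≠ ∞) (f : C(AddCircle T, ℂ)) :
    ‖contLp p f‖ ^ p.toReal = ∫ x, ‖f x‖ ^ p.toReal ∂haarAddCircle := by
  have hp0 : p ≠ 0 := (zero_lt_one.trans_le (Fact.out : 1 ≤ p)).ne'
  have h0 : 0 ≤ ∫ x, ‖f x‖ ^ p.toReal ∂haarAddCircle := integral_nonneg fun x => by positivity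
  rw [norm_contLp_eq_eLpNorm, MemLp.eLpNorm_eq_integral_rpow_norm hp0 hp
    (ContinuousMap.memLp haarAddCircle ℂ f), ENNReal.toReal_ofReal (Real.rpow_nonneg h0 _),
    Real.rpow_inv_rpow h0 (ENNReal.toReal_pos hp0 hp).ne']

theorem norm_contLp_mono {f g : C(AddCircle T, ℂ)} (h : ∀ x, ‖f x‖ ≤ ‖g x‖) :
    ‖contLp p f‖ ≤ ‖contLp p g‖ := by
  refine Lp.norm_le_norm_of_ae_le ?_
  filter_upwards [ContinuousMap.coeFn_toLp (p := p) (𝕜 := ℂ) haarAddCircle f,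
    ContinuousMap.coeFn_toLp (p := p) (𝕜 := ℂ) haarAddCircle g] with x hf hg
  rw [hf, hg]
  exact h x

theorem norm_contLp_fourier_mul (k : ℤ) (f : C(AddCircle T, ℂ)) :
    ‖contLp p (fourier k * f)‖ = ‖contLp p f‖ := by
  have h : ∀ x : AddCircle T, ‖(fourier k * f : C(AddCircle T, ℂ)) x‖ = ‖f x‖ := fun x => by
    rw [ContinuousMap.mul_apply, norm_mul, fourier_apply, Circle.norm_coe, one_mul]
  exact le_antisymm (norm_contLp_mono fun x => (h x).le) (norm_contLp_mono fun x => (h x).ge)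

theorem norm_contLp_le (f : C(AddCircle T, ℂ)) : ‖contLp p f‖ ≤ ‖f‖ := by
  have h := Lp.norm_le_of_ae_bound (f := contLp p f) (norm_nonneg f) (by
    filter_upwards [ContinuousMap.coeFn_toLp (p := p) (𝕜 := ℂ) haarAddCircle f] with x hf
    rw [hf]
    exact f.norm_coe_le_norm x)
  simpa [measureUnivNNReal] using h

theorem norm_contLp_le_of_exponent_le {q : ℝ≥0∞} [Fact (1 ≤ q)] (hpq : p ≤ q)
    (f : C(AddCircle T, ℂ)) : ‖contLp p f‖ ≤ ‖contLp q f‖ := by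
  rw [norm_contLp_eq_eLpNorm, norm_contLp_eq_eLpNorm]
  exact ENNReal.toReal_mono (ContinuousMap.memLp haarAddCircle ℂ f).eLpNorm_ne_top
    (eLpNorm_le_eLpNorm_of_exponent_le hpq f.continuous.aestronglyMeasurable)

theorem norm_fourierCoeff_le (f : Lp ℂ p (@haarAddCircle T hT)) (k : ℤ) :
    ‖fourierCoeff f k‖ ≤ ‖f‖ := by
  have hm := Lp.memLp f
  have h1 : ‖fourierCoeff f k‖ ≤ ∫ x, ‖f x‖ ∂haarAddCircle := by
    refine (norm_integral_le_integral_norm _).trans_eq ?_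
    refine integral_congr_ae (Eventually.of_forall fun x => ?_)
    simp only [norm_smul, fourier_apply, Circle.norm_coe, one_mul]
  refine h1.trans ?_
  rw [integral_norm_eq_lintegral_enorm hm.aestronglyMeasurable, ← eLpNorm_one_eq_lintegral_enorm,
    Lp.norm_def]
  exact ENNReal.toReal_mono hm.eLpNorm_ne_top
    (eLpNorm_le_eLpNorm_of_exponent_le Fact.out hm.aestronglyMeasurable)

theorem fourierCoeff_contLp (f : C(AddCircle T, ℂ)) (k : ℤ) :
    fourierCoeff (contLp p f) k = fourierCoeff f k :=
  congrFun (fourierCoeff_congr_ae (ContinuousMap.coeFn_toLp haarAddCircle f)) k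

/-- Bessel's inequality for partial Fourier sums. -/
theorem norm_contLp_two_fourierSum_le (s : Finset ℤ) (f : C(AddCircle T, ℂ)) :
    ‖contLp 2 (fourierSum s f)‖ ≤ ‖contLp 2 f‖ := by
  have hin : ∀ k, inner ℂ (fourierLp 2 k) (contLp 2 f) = fourierCoeff f k := by
    intro k
    rw [ContinuousMap.inner_toLp, fourierCoeff]
    refine integral_congr_ae (Eventually.of_forall fun x => ?_)
    simp only [smul_eq_mul, fourier_neg, mul_comm]
  have hs : contLp 2 (fourierSum s f) = ∑ k ∈ s, fourierCoeff f k • fourierLp 2 k := by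
    simp [fourierSum, contLp]
  refine le_of_sq_le_sq ?_ (norm_nonneg _)
  have h1 := (orthonormal_fourier (T := T)).sum_inner_products_le (contLp 2 f) (s := s)
  refine le_trans (le_of_eq ?_) h1
  have h2 := (orthonormal_fourier (T := T)).inner_sum (fourierCoeff f) (fourierCoeff f) s
  rw [← hs, inner_self_eq_norm_sq_to_K] at h2
  simp only [hin]
  have h3 : ∀ z : ℂ, (starRingEnd ℂ) z * z = ((‖z‖ ^ 2 : ℝ) : ℂ) := fun z => by
    rw [mul_comm, Complex.mul_conj']; push_cast; rfl
  simp only [h3] at h2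
  refine Complex.ofReal_injective ?_
  push_cast at h2 ⊢
  exact h2

/-! ### The analytic part of a positive trigonometric polynomial -/

theorem fourier_one_pow {T : ℝ} (n : ℕ) (x : AddCircle T) :
    (fourier 1 x : ℂ) ^ n = fourier (n : ℤ) x := by
  induction n with
  | zero => simp
  | succ n ih => rw [pow_succ, ih, Nat.cast_succ, fourier_add]

theorem exists_fourier_one_eq {z : ℂ} (hz : z ∈ Metric.sphere (0 : ℂ) 1) :
    ∃ x : AddCircle T, (fourier 1 x : ℂ) = z := by
  obtain ⟨x, hx⟩ := (AddCircle.homeomorphCircle hT.out.ne').surjective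
    ⟨z, mem_sphere_zero_iff_norm.1 hz |> fun h => by simpa [Submonoid.unitSphere] using h⟩
  refine ⟨x, ?_⟩
  rw [fourier_one, ← AddCircle.homeomorphCircle_apply hT.out.ne', hx]

/-- For a real trigonometric polynomial `f` of degree at most `n`, with analytic part
`g = ∑_{0 ≤ k ≤ n} c_k e_k`, one has `f = g + conj g - c_0`. -/
theorem add_conj_fourierSum_Icc {f : C(AddCircle T, ℂ)} (hre : ∀ x, (f x).im = 0) {n : ℕ}
    (hn : fourierSum (Finset.Icc (-(n : ℤ)) n) f = f) (x : AddCircle T) :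
    fourierSum (Finset.Icc 0 (n : ℤ)) f x
      + (starRingEnd ℂ) (fourierSum (Finset.Icc 0 (n : ℤ)) f x) - fourierCoeff f 0 = f x := by
  have hconj : ∀ k, (starRingEnd ℂ) (fourierCoeff f k) = fourierCoeff f (-k) := by
    intro k
    rw [← fourierCoeff_conj]
    congr 1
    ext x
    exact Complex.conj_eq_iff_im.2 (hre x)
  have h1 : (starRingEnd ℂ) (fourierSum (Finset.Icc 0 (n : ℤ)) f x)
      = ∑ k ∈ Finset.Icc (-(n : ℤ)) 0, fourierCoeff f k * fourier k x := by
    rw [fourierSum_apply, map_sum]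
    refine Finset.sum_nbij' (fun k => -k) (fun k => -k) ?_ ?_ ?_ ?_ ?_
    · intro k hk; rw [Finset.mem_Icc] at hk ⊢; omega
    · intro k hk; rw [Finset.mem_Icc] at hk ⊢; omega
    · simp
    · simp
    · intro k _
      rw [map_mul, hconj, fourier_neg]
  have h2 := Finset.sum_union_inter (s₁ := Finset.Icc 0 (n : ℤ)) (s₂ := Finset.Icc (-(n : ℤ)) 0)
    (f := fun k => fourierCoeff f k * fourier k x)
  have e1 : Finset.Icc 0 (n : ℤ) ∪ Finset.Icc (-(n : ℤ)) 0 = Finset.Icc (-(n : ℤ)) n := by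
    ext k; simp only [Finset.mem_union, Finset.mem_Icc]; omega
  have e2 : Finset.Icc 0 (n : ℤ) ∩ Finset.Icc (-(n : ℤ)) 0 = {0} := by
    ext k; simp only [Finset.mem_inter, Finset.mem_Icc, Finset.mem_singleton]; omega
  rw [e1, e2, Finset.sum_singleton, ← h1, ← fourierSum_apply, ← fourierSum_apply, hn,
    fourier_zero, mul_one] at h2
  rw [← h2, add_sub_cancel_right]

/-- The projection onto nonnegative frequencies is bounded in `L^p` on positive trigonometric
polynomials. -/
theorem exists_norm_fourierSum_le_of_pos (hp1 : 1 < p) (hp2 : p ≤ 2) :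
    ∃ C : ℝ, 0 ≤ C ∧ ∀ f : C(AddCircle T, ℂ), (∀ x, (f x).im = 0) → ∀ ε : ℝ, 0 < ε →
      (∀ x, ε ≤ (f x).re) → ∀ n : ℕ, fourierSum (Finset.Icc (-(n : ℤ)) n) f = f →
      ‖contLp p (fourierSum (Finset.Icc 0 (n : ℤ)) f)‖ ≤ C * ‖contLp p f‖ := by
  have hptop : p ≠ ∞ := (hp2.trans_lt (by simp)).ne
  have hpr1 : 1 < p.toReal := by
    rw [← ENNReal.toReal_one]; exact (ENNReal.toReal_lt_toReal (by simp) hptop).2 hp1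
  have hpr2 : p.toReal ≤ 2 := by
    simpa using (ENNReal.toReal_le_toReal hptop (by simp)).2 hp2
  obtain ⟨A, hA, hmain⟩ := exists_integral_norm_rpow_le_integral_re_rpow T hpr1 hpr2
  refine ⟨(A ^ p.toReal⁻¹ + 1) / 2, by positivity, fun f him ε hε hre n hn => ?_⟩
  set g := fourierSum (Finset.Icc 0 (n : ℤ)) f with hg
  set c := fourierCoeff f 0 with hc
  -- the holomorphic function with boundary values `2 g - c`
  let F : ℂ → ℂ := fun z => 2 * ∑ k ∈ Finset.range (n + 1), fourierCoeff f (k : ℤ) * z ^ k - c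
  have hgsum : ∀ x : AddCircle T,
      g x = ∑ k ∈ Finset.range (n + 1), fourierCoeff f (k : ℤ) * (fourier 1 x) ^ k := by
    intro x
    rw [hg, fourierSum_apply]
    refine Finset.sum_nbij' Int.toNat (fun k : ℕ => (k : ℤ)) ?_ ?_ ?_ ?_ ?_
    · intro k hk; rw [Finset.mem_Icc] at hk; rw [Finset.mem_range]; omega
    · intro k hk; rw [Finset.mem_range] at hk; rw [Finset.mem_Icc]; omega
    · intro k hk; rw [Finset.mem_Icc] at hk; exact Int.toNat_of_nonneg hk.1
    · intro k _; simp
    · intro k hk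
      rw [Finset.mem_Icc] at hk
      rw [fourier_one_pow, Int.toNat_of_nonneg hk.1]
  have hFx : ∀ x : AddCircle T, F (fourier 1 x) = 2 * g x - c := fun x => by
    rw [hgsum]
  have hFre : ∀ x : AddCircle T, (F (fourier 1 x)).re = (f x).re := by
    intro x
    rw [hFx, ← add_conj_fourierSum_Icc him hn x, ← hg, ← hc]
    simp only [Complex.sub_re, Complex.add_re, Complex.conj_re, Complex.mul_re, Complex.re_ofNat,
      Complex.im_ofNat]
    ring
  have hF : DiffContOnCl ℂ F (Metric.ball 0 1) := by
    apply Differentiable.diffContOnCl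
    fun_prop
  have hF0 : F 0 = c := by
    have : ∑ k ∈ Finset.range (n + 1), fourierCoeff f (k : ℤ) * (0 : ℂ) ^ k = c := by
      rw [Finset.sum_eq_single_of_mem 0 (by simp) fun k _ hk => by rw [zero_pow hk, mul_zero]]
      simp [hc]
    simp only [F]
    rw [this]
    ring
  have hcim : c.im = 0 := by
    have := fourierCoeff_conj f 0
    rw [neg_zero] at this
    rw [← Complex.conj_eq_iff_im, hc, ← this]
    congr 1
    ext x
    exact Complex.conj_eq_iff_im.2 (him x)
  have hmain' := hmain F hF (hF0 ▸ hcim) ε hε fun z hz => by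
    obtain ⟨x, rfl⟩ := exists_fourier_one_eq (T := T) hz
    rw [hFre]
    exact hre x
  let h : C(AddCircle T, ℂ) := (2 : ℂ) • g - c • fourier 0
  have hh : ∀ x, F (fourier 1 x) = h x := by
    intro x
    simp only [h, ContinuousMap.sub_apply, ContinuousMap.smul_apply, smul_eq_mul, fourier_zero,
      mul_one, hFx]
  have hf : ∀ x, (f x).re = ‖f x‖ := by
    intro x
    have e : f x = ((f x).re : ℂ) := Complex.ext rfl (by simpa using him x)
    conv_rhs => rw [e]
    rw [Complex.norm_real, Real.norm_of_nonneg (hε.le.trans (hre x))]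
  simp only [hFre, hf] at hmain'
  simp only [hh] at hmain'
  rw [← norm_contLp_rpow hptop, ← norm_contLp_rpow hptop] at hmain'
  have hh' : ‖contLp p h‖ ≤ A ^ p.toReal⁻¹ * ‖contLp p f‖ := by
    have hp0 : 0 < p.toReal := by linarith
    rw [← Real.rpow_le_rpow_iff (norm_nonneg _) (by positivity) hp0,
      Real.mul_rpow (by positivity) (norm_nonneg _), Real.rpow_inv_rpow hA hp0.ne']
    exact hmain'
  have hc' : ‖contLp p (c • fourier 0 : C(AddCircle T, ℂ))‖ ≤ ‖contLp p f‖ := by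
    refine (norm_contLp_le _).trans ?_
    rw [norm_smul, fourier_norm, mul_one, hc, ← fourierCoeff_contLp (p := p)]
    exact norm_fourierCoeff_le _ 0
  have hgh : g = (1 / 2 : ℂ) • (h + c • fourier 0) := by
    simp only [h, sub_add_cancel, smul_smul]
    norm_num
  rw [hgh, map_smul, norm_smul, map_add]
  have h3 := norm_add_le (contLp p h) (contLp p (c • fourier 0 : C(AddCircle T, ℂ)))
  have h4 : ‖(1 / 2 : ℂ)‖ = 1 / 2 := by norm_num
  rw [h4]
  linarith

/-! ### The analytic part of a continuous function -/

/-- A nonnegative continuous function is a uniform limit of positive trigonometric polynomials,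
namely of `|q|² + δ` with trigonometric polynomials `q` approximating its square root. -/
theorem exists_pos_trigPoly_near (g : C(AddCircle T, ℝ)) (hg : ∀ x, 0 ≤ g x) {δ : ℝ}
    (hδ : 0 < δ) :
    ∃ u ∈ Submodule.span ℂ (Set.range (@fourier T)), (∀ x, (u x).im = 0) ∧
      (∃ ε > 0, ∀ x, ε ≤ (u x).re) ∧
      ∀ f : C(AddCircle T, ℂ), (∀ x, f x = g x) → ‖f - u‖ ≤ δ := by
  let r : C(AddCircle T, ℂ) := ⟨fun x => (Real.sqrt (g x) : ℂ), by fun_prop⟩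
  have hr : r ∈ closure (fourierSubalgebra (T := T) : Set C(AddCircle T, ℂ)) := by
    rw [← StarSubalgebra.topologicalClosure_coe, fourierSubalgebra_closure_eq_top]
    trivial
  have hcont : Continuous fun q : C(AddCircle T, ℂ) => star q * q := by fun_prop
  have hopen : IsOpen {q : C(AddCircle T, ℂ) | dist (star q * q) (star r * r) < δ / 2} :=
    isOpen_lt (hcont.dist continuous_const) continuous_const
  obtain ⟨q, hq, hqA⟩ := mem_closure_iff.1 hr _ hopen (by simpa using half_pos hδ)
  have hux : ∀ x, (star q * q + ((δ / 2 : ℝ) : ℂ) • 1 : C(AddCircle T, ℂ)) x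
      = ((Complex.normSq (q x) + δ / 2 : ℝ) : ℂ) := by
    intro x
    have : (starRingEnd ℂ) (q x) * q x = Complex.normSq (q x) := by
      rw [mul_comm, Complex.mul_conj]
    simp [this]
  refine ⟨star q * q + ((δ / 2 : ℝ) : ℂ) • 1, ?_, fun x => ?_, ⟨δ / 2, half_pos hδ, fun x => ?_⟩,
    fun f hf => ?_⟩
  · rw [← fourierSubalgebra_coe]
    have hq' : q ∈ fourierSubalgebra (T := T) := hqA
    have hu : star q * q + ((δ / 2 : ℝ) : ℂ) • 1 ∈ fourierSubalgebra (T := T) :=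
      add_mem (mul_mem (star_mem hq') hq') (SMulMemClass.smul_mem _ (one_mem _))
    exact hu
  · rw [hux, Complex.ofReal_im]
  · rw [hux, Complex.ofReal_re]
    linarith [Complex.normSq_nonneg (q x)]
  · have hfr : f = star r * r := by
      ext x
      have : (Real.sqrt (g x) : ℂ) * Real.sqrt (g x) = g x := by
        rw [← Complex.ofReal_mul, Real.mul_self_sqrt (hg x)]
      simp [hf, r, this]
    rw [hfr, ← sub_sub]
    refine (norm_sub_le _ _).trans ?_
    have h1 : ‖star r * r - star q * q‖ ≤ δ / 2 := by
      rw [← dist_eq_norm, dist_comm]; exact le_of_lt hq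
    have h2 : ‖(((δ / 2 : ℝ) : ℂ) • 1 : C(AddCircle T, ℂ))‖ ≤ δ / 2 := by
      rw [norm_smul, norm_one, mul_one, Complex.norm_real, Real.norm_of_nonneg (half_pos hδ).le]
    linarith

theorem exists_eventually_norm_fourierSum_le_of_nonneg (hp1 : 1 < p) (hp2 : p ≤ 2) :
    ∃ C : ℝ, 0 ≤ C ∧ ∀ (g : C(AddCircle T, ℝ)), (∀ x, 0 ≤ g x) →
      ∀ f : C(AddCircle T, ℂ), (∀ x, f x = g x) → ∀ ε : ℝ, 0 < ε →
      ∀ᶠ n : ℕ in atTop, ‖contLp p (fourierSum (Finset.Icc 0 (n : ℤ)) f)‖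
        ≤ C * ‖contLp p f‖ + ε := by
  obtain ⟨C, hC, hpos⟩ := exists_norm_fourierSum_le_of_pos (T := T) hp1 hp2
  refine ⟨C, hC, fun g hg f hf ε hε => ?_⟩
  have hδ : 0 < ε / (C + 1) := by positivity
  obtain ⟨u, hu, him, ⟨η, hη, hre⟩, happ⟩ := exists_pos_trigPoly_near g hg hδ
  filter_upwards [eventually_fourierSum_eq hu] with n hn
  have h1 := hpos u him η hη hre n hn
  have h2 := happ f hf
  -- the error is controlled in `L²` by Bessel's inequality
  have h3 : ‖contLp p (fourierSum (Finset.Icc 0 (n : ℤ)) (f - u : C(AddCircle T, ℂ)))‖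
      ≤ ε / (C + 1) :=
    (norm_contLp_le_of_exponent_le hp2 _).trans
      ((norm_contLp_two_fourierSum_le _ _).trans ((norm_contLp_le _).trans h2))
  have h4 : ‖contLp p u‖ ≤ ‖contLp p f‖ + ε / (C + 1) := by
    have e : contLp p u = contLp p f - contLp p (f - u) := by
      rw [← map_sub, sub_sub_cancel]
    rw [e]
    exact (norm_sub_le _ _).trans (by gcongr; exact (norm_contLp_le _).trans h2)
  have e : fourierSum (Finset.Icc 0 (n : ℤ)) f = fourierSum (Finset.Icc 0 (n : ℤ)) u
      + fourierSum (Finset.Icc 0 (n : ℤ)) (f - u : C(AddCircle T, ℂ)) := by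
    rw [fourierSum_sub, add_sub_cancel]
  rw [e, map_add]
  refine (norm_add_le _ _).trans ?_
  have h5 : C * ‖contLp p u‖ ≤ C * (‖contLp p f‖ + ε / (C + 1)) := by gcongr
  have h6 : C * (ε / (C + 1)) + ε / (C + 1) = ε := by field_simp
  linarith

/-- The projection onto nonnegative frequencies is bounded in `L^p`, `1 < p ≤ 2`. -/
theorem exists_eventually_norm_fourierSum_Icc_zero_le (hp1 : 1 < p) (hp2 : p ≤ 2) :
    ∃ C : ℝ, 0 ≤ C ∧ ∀ (f : C(AddCircle T, ℂ)) (ε : ℝ), 0 < ε →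
      ∀ᶠ n : ℕ in atTop, ‖contLp p (fourierSum (Finset.Icc 0 (n : ℤ)) f)‖
        ≤ C * ‖contLp p f‖ + ε := by
  obtain ⟨C, hC, hpos⟩ := exists_eventually_norm_fourierSum_le_of_nonneg (T := T) hp1 hp2
  have hadd : ∀ (D : ℝ) (c : ℂ) (f g h : C(AddCircle T, ℂ)), 0 ≤ D → f = g + c • h → ‖c‖ = 1 →
      ‖contLp p g‖ ≤ ‖contLp p f‖ → ‖contLp p h‖ ≤ ‖contLp p f‖ →
      (∀ ε : ℝ, 0 < ε → ∀ᶠ n : ℕ in atTop,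
        ‖contLp p (fourierSum (Finset.Icc 0 (n : ℤ)) g)‖ ≤ D * ‖contLp p g‖ + ε) →
      (∀ ε : ℝ, 0 < ε → ∀ᶠ n : ℕ in atTop,
        ‖contLp p (fourierSum (Finset.Icc 0 (n : ℤ)) h)‖ ≤ D * ‖contLp p h‖ + ε) →
      ∀ ε : ℝ, 0 < ε → ∀ᶠ n : ℕ in atTop,
        ‖contLp p (fourierSum (Finset.Icc 0 (n : ℤ)) f)‖ ≤ 2 * D * ‖contLp p f‖ + ε := by
    intro D c f g h hD hf hc hgf hhf hg hh ε hε
    filter_upwards [hg (ε / 2) (half_pos hε), hh (ε / 2) (half_pos hε)] with n h1 h2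
    have e : contLp p (fourierSum (Finset.Icc 0 (n : ℤ)) f)
        = contLp p (fourierSum (Finset.Icc 0 (n : ℤ)) g)
          + c • contLp p (fourierSum (Finset.Icc 0 (n : ℤ)) h) := by
      rw [hf, fourierSum_add, fourierSum_smul, map_add, map_smul]
    rw [e]
    refine (norm_add_le _ _).trans ?_
    rw [norm_smul, hc, one_mul]
    have := mul_le_mul_of_nonneg_left hgf hD
    have := mul_le_mul_of_nonneg_left hhf hD
    linarith
  -- real functions split into positive and negative parts
  have hreal : ∀ f : C(AddCircle T, ℂ), (∀ x, (f x).im = 0) → ∀ ε : ℝ, 0 < ε →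
      ∀ᶠ n : ℕ in atTop, ‖contLp p (fourierSum (Finset.Icc 0 (n : ℤ)) f)‖
        ≤ 2 * C * ‖contLp p f‖ + ε := by
    intro f him
    let a : C(AddCircle T, ℝ) := ⟨fun x => max (f x).re 0, by fun_prop⟩
    let b : C(AddCircle T, ℝ) := ⟨fun x => max (-(f x).re) 0, by fun_prop⟩
    let a' : C(AddCircle T, ℂ) := ⟨fun x => (a x : ℂ), by fun_prop⟩
    let b' : C(AddCircle T, ℂ) := ⟨fun x => (b x : ℂ), by fun_prop⟩
    refine hadd C (-1) f a' b' hC ?_ (by simp) (norm_contLp_mono fun x => ?_)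
      (norm_contLp_mono fun x => ?_) (hpos a (fun x => le_max_right _ _) a' fun x => rfl)
      (hpos b (fun x => le_max_right _ _) b' fun x => rfl)
    · ext x
      have e : f x = ((f x).re : ℂ) := Complex.ext rfl (by simpa using him x)
      have h : (f x).re = max (f x).re 0 + -1 * max (-(f x).re) 0 := by
        rcases le_total (f x).re 0 with h | h
        · rw [max_eq_right h, max_eq_left (by linarith)]; ring
        · rw [max_eq_left h, max_eq_right (by linarith)]; ring
      rw [e, h]
      simp [a', b', a, b]
    · refine le_trans ?_ (Complex.abs_re_le_norm (f x))
      simp only [a', a, ContinuousMap.coe_mk, Complex.norm_real, Real.norm_eq_abs]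
      rw [abs_of_nonneg (le_max_right _ _)]
      exact max_le (le_abs_self _) (abs_nonneg _)
    · refine le_trans ?_ (Complex.abs_re_le_norm (f x))
      simp only [b', b, ContinuousMap.coe_mk, Complex.norm_real, Real.norm_eq_abs]
      rw [abs_of_nonneg (le_max_right _ _)]
      exact max_le (neg_le_abs _) (abs_nonneg _)
  refine ⟨2 * (2 * C), by positivity, fun f => ?_⟩
  let a : C(AddCircle T, ℂ) := ⟨fun x => ((f x).re : ℂ), by fun_prop⟩
  let b : C(AddCircle T, ℂ) := ⟨fun x => ((f x).im : ℂ), by fun_prop⟩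
  refine hadd (2 * C) Complex.I f a b (by positivity) ?_ (by simp)
    (norm_contLp_mono fun x => ?_) (norm_contLp_mono fun x => ?_)
    (hreal a fun x => by simp [a]) (hreal b fun x => by simp [b])
  · ext x
    simp only [a, b, ContinuousMap.add_apply, ContinuousMap.smul_apply, ContinuousMap.coe_mk,
      smul_eq_mul]
    rw [mul_comm, Complex.re_add_im]
  · simpa [a] using Complex.abs_re_le_norm (f x)
  · simpa [b] using Complex.abs_im_le_norm (f x)

/-! ### Riesz's theorem for continuous functions -/

/-- The frequencies in `[-m, m]` are those `≥ -m` without those `≥ m + 1`; both projections are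
modulations of the one onto nonnegative frequencies. All sums are cut off at `n + m + 1`. -/
theorem fourierSum_Icc_eq_sub (m n : ℕ) (f : C(AddCircle T, ℂ)) :
    fourierSum (Finset.Icc (-(m : ℤ)) m) f
      = fourier (-(m : ℤ)) * fourierSum (Finset.Icc 0 ((n + 2 * m + 1 : ℕ) : ℤ))
            (fourier (m : ℤ) * f : C(AddCircle T, ℂ))
        - fourier (m + 1 : ℤ) * fourierSum (Finset.Icc 0 (n : ℤ))
            (fourier (-(m + 1 : ℤ)) * f : C(AddCircle T, ℂ)) := by
  have h := fourier_mul_fourierSum_Icc (-(m : ℤ)) 0 ((n + 2 * m + 1 : ℕ) : ℤ) f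
  rw [neg_neg] at h
  rw [h, fourier_mul_fourierSum_Icc, eq_sub_iff_add_eq, fourierSum, fourierSum, fourierSum,
    ← Finset.sum_union]
  · congr 1
    ext k; simp only [Finset.mem_union, Finset.mem_Icc]; push_cast; omega
  · rw [Finset.disjoint_left]
    intro k h1 h2
    rw [Finset.mem_Icc] at h1 h2
    omega

theorem exists_norm_fourierSum_le_of_le_two (hp1 : 1 < p) (hp2 : p ≤ 2) :
    ∃ C : ℝ, 0 ≤ C ∧ ∀ (f : C(AddCircle T, ℂ)) (m : ℕ),
      ‖contLp p (fourierSum (Finset.Icc (-(m : ℤ)) m) f)‖ ≤ C * ‖contLp p f‖ := by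
  obtain ⟨C, hC, hb⟩ := exists_eventually_norm_fourierSum_Icc_zero_le (T := T) hp1 hp2
  refine ⟨2 * C, by positivity, fun f m => le_of_forall_pos_le_add fun ε hε => ?_⟩
  have h1 := hb (fourier (m : ℤ) * f) (ε / 2) (half_pos hε)
  have h2 := hb (fourier (-(m + 1 : ℤ)) * f) (ε / 2) (half_pos hε)
  obtain ⟨N, hN⟩ := eventually_atTop.1 (h1.and h2)
  have h3 := (hN (N + 2 * m + 1) (by omega)).1
  have h4 := (hN N le_rfl).2
  rw [norm_contLp_fourier_mul] at h3 h4
  rw [fourierSum_Icc_eq_sub m N f, map_sub]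
  refine (norm_sub_le _ _).trans ?_
  rw [norm_contLp_fourier_mul, norm_contLp_fourier_mul]
  linarith

theorem norm_integral_mul_le {q : ℝ≥0∞} [Fact (1 ≤ q)] (hp : p ≠ ∞) (hq : q ≠ ∞)
    (hpq : p.toReal.HolderConjugate q.toReal) (f g : C(AddCircle T, ℂ)) :
    ‖∫ x, f x * g x ∂haarAddCircle‖ ≤ ‖contLp p f‖ * ‖contLp q g‖ := by
  have h := integral_mul_norm_le_Lp_mul_Lq (μ := @haarAddCircle T hT) (f := f) (g := g) hpq
    (by rw [ENNReal.ofReal_toReal hp]; exact ContinuousMap.memLp haarAddCircle ℂ f)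
    (by rw [ENNReal.ofReal_toReal hq]; exact ContinuousMap.memLp haarAddCircle ℂ g)
  rw [← norm_contLp_rpow hp, ← norm_contLp_rpow hq, one_div, one_div,
    Real.rpow_rpow_inv (norm_nonneg _) hpq.pos.ne',
    Real.rpow_rpow_inv (norm_nonneg _) hpq.symm.pos.ne'] at h
  refine (norm_integral_le_integral_norm _).trans (le_trans (le_of_eq ?_) h)
  simp only [norm_mul]

/-- A bound for the partial sums in `L^q` passes to the conjugate exponent `p ≥ 2`: pair the partial
sum `h` of `f` with `conj h * |h| ^ (p - 2)`. -/
theorem norm_fourierSum_le_of_conjugate {q : ℝ≥0∞} [Fact (1 ≤ q)] (hp : p ≠ ∞) (hq : q ≠ ∞)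
    (hp2 : 2 ≤ p.toReal) (hpq : p.toReal.HolderConjugate q.toReal) {C : ℝ} (m : ℕ)
    (hC : ∀ g : C(AddCircle T, ℂ),
      ‖contLp q (fourierSum (Finset.Icc (-(m : ℤ)) m) g)‖ ≤ C * ‖contLp q g‖)
    (f : C(AddCircle T, ℂ)) :
    ‖contLp p (fourierSum (Finset.Icc (-(m : ℤ)) m) f)‖ ≤ C * ‖contLp p f‖ := by
  have hC0 : 0 ≤ C := by
    have h1 := (norm_nonneg _).trans (hC 1)
    by_contra! hneg
    have h2 : ‖contLp q (1 : C(AddCircle T, ℂ))‖ = 0 :=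
      le_antisymm (by nlinarith [norm_nonneg (contLp q (1 : C(AddCircle T, ℂ)))]) (norm_nonneg _)
    have h3 := norm_contLp_rpow hq (1 : C(AddCircle T, ℂ))
    rw [h2, Real.zero_rpow hpq.symm.pos.ne'] at h3
    simp at h3
  set h := fourierSum (Finset.Icc (-(m : ℤ)) m) f with hh
  set P := p.toReal with hP
  let g : C(AddCircle T, ℂ) := ⟨fun x => (starRingEnd ℂ) (h x) * ((‖h x‖ ^ (P - 2) : ℝ) : ℂ), by
    have : Continuous fun x => ‖h x‖ ^ (P - 2) :=
      h.continuous.norm.rpow_const fun _ => Or.inr (by linarith)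
    fun_prop⟩
  have hhg : ∀ x, h x * g x = ((‖h x‖ ^ P : ℝ) : ℂ) := by
    intro x
    have e : ‖h x‖ ^ P = ‖h x‖ ^ 2 * ‖h x‖ ^ (P - 2) := by
      rw [← Real.rpow_natCast, ← Real.rpow_add_of_nonneg (norm_nonneg _) (by norm_num) (by linarith)]
      congr 1
      push_cast; ring
    rw [e]
    simp only [g, ContinuousMap.coe_mk]
    rw [← mul_assoc, Complex.mul_conj']
    push_cast
    rfl
  have hgn : ∀ x, ‖g x‖ ^ q.toReal = ‖h x‖ ^ P := by
    intro x
    have e : ‖g x‖ = ‖h x‖ ^ (P - 1) := by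
      simp only [g, ContinuousMap.coe_mk, norm_mul, RCLike.norm_conj, Complex.norm_real]
      rw [Real.norm_of_nonneg (Real.rpow_nonneg (norm_nonneg _) _)]
      nth_rewrite 1 [← Real.rpow_one ‖h x‖]
      rw [← Real.rpow_add_of_nonneg (norm_nonneg _) (by norm_num) (by linarith)]
      congr 1; ring
    rw [e, ← Real.rpow_mul (norm_nonneg _), hpq.sub_one_mul_conj]
  have hgnorm : ‖contLp q g‖ = ‖contLp p h‖ ^ (P - 1) := by
    have e := norm_contLp_rpow hq g
    simp only [hgn] at e
    rw [← norm_contLp_rpow hp, ← hP, ← hpq.sub_one_mul_conj, Real.rpow_mul (norm_nonneg _)] at e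
    exact (Real.rpow_left_inj (norm_nonneg _) (by positivity) hpq.symm.pos.ne').1 e
  have key : ‖contLp p h‖ ^ P ≤ ‖contLp p f‖ * (C * ‖contLp p h‖ ^ (P - 1)) := by
    calc ‖contLp p h‖ ^ P = ‖∫ x, h x * g x ∂haarAddCircle‖ := by
          simp only [hhg]
          rw [integral_complex_ofReal, ← norm_contLp_rpow hp, Complex.norm_real,
            Real.norm_of_nonneg (Real.rpow_nonneg (norm_nonneg _) _)]
      _ = ‖∫ x, f x * fourierSum (Finset.Icc (-(m : ℤ)) m) g x ∂haarAddCircle‖ := by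
          rw [hh, integral_fourierSum_mul_comm]
      _ ≤ _ := (norm_integral_mul_le hp hq hpq f _).trans (by
          rw [← hgnorm]
          gcongr
          exact hC g)
  rcases (norm_nonneg (contLp p h)).eq_or_lt with h0 | h0
  · rw [← h0]; positivity
  · have e : ‖contLp p h‖ ^ P = ‖contLp p h‖ * ‖contLp p h‖ ^ (P - 1) := by
      nth_rewrite 2 [← Real.rpow_one ‖contLp p h‖]
      rw [← Real.rpow_add h0]
      congr 1; ring
    rw [e] at key
    refine le_of_mul_le_mul_right (key.trans_eq ?_) (Real.rpow_pos_of_pos h0 (P - 1))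
    ring

theorem exists_norm_fourierSum_le (hp1 : 1 < p) (hp : p ≠ ∞) :
    ∃ C : ℝ, 0 ≤ C ∧ ∀ (f : C(AddCircle T, ℂ)) (m : ℕ),
      ‖contLp p (fourierSum (Finset.Icc (-(m : ℤ)) m) f)‖ ≤ C * ‖contLp p f‖ := by
  rcases le_total p 2 with h2 | h2
  · exact exists_norm_fourierSum_le_of_le_two hp1 h2
  have hP : 2 ≤ p.toReal := by
    simpa using (ENNReal.toReal_le_toReal (by simp) hp).2 h2
  have hpq := Real.HolderConjugate.conjExponent (p := p.toReal) (by linarith)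
  have hq0 := hpq.symm.pos
  have hq1 : 1 < p.toReal.conjExponent := hpq.symm.lt
  have hq2 : p.toReal.conjExponent ≤ 2 := by
    rw [Real.conjExponent, div_le_iff₀ (by linarith)]
    linarith
  have hqE1 : 1 < ENNReal.ofReal p.toReal.conjExponent := by simpa using hq1
  have : Fact (1 ≤ ENNReal.ofReal p.toReal.conjExponent) := ⟨hqE1.le⟩
  obtain ⟨C, hC0, hC⟩ := exists_norm_fourierSum_le_of_le_two (T := T) hqE1
    (by rw [ENNReal.ofReal_le_iff_le_toReal (by simp)]; simpa using hq2)
  refine ⟨C, hC0, fun f m => ?_⟩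
  refine norm_fourierSum_le_of_conjugate (q := ENNReal.ofReal p.toReal.conjExponent) hp
    ENNReal.ofReal_ne_top hP ?_ m (fun g => hC g m) f
  rwa [ENNReal.toReal_ofReal hq0.le]

/-! ### Riesz's theorem in `L^p` -/

/-- The partial sum of the Fourier series as a bounded operator on `L^p`. -/
noncomputable def fourierSumCLM (p : ℝ≥0∞) [Fact (1 ≤ p)] (s : Finset ℤ) :
    Lp ℂ p (@haarAddCircle T hT) →L[ℂ] Lp ℂ p (@haarAddCircle T hT) :=
  LinearMap.mkContinuous
    { toFun := fun f => contLp p (fourierSum s f)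
      map_add' := fun f g => by
        have h : fourierCoeff (f + g : Lp ℂ p (@haarAddCircle T hT))
            = fourierCoeff f + fourierCoeff g := by
          rw [fourierCoeff_congr_ae (Lp.coeFn_add f g),
            fourierCoeff.add ((Lp.memLp f).integrable Fact.out) ((Lp.memLp g).integrable Fact.out)]
        rw [← map_add]
        congr 1
        simp only [fourierSum, h, Pi.add_apply, add_smul, Finset.sum_add_distrib]
      map_smul' := fun c f => by
        have h : ∀ k, fourierCoeff (c • f : Lp ℂ p (@haarAddCircle T hT)) k
            = c * fourierCoeff f k := by
          intro k
          rw [fourierCoeff_congr_ae (Lp.coeFn_smul c f), fourierCoeff.const_smul, smul_eq_mul]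
        rw [RingHom.id_apply, ← map_smul]
        congr 1
        simp only [fourierSum, h, Finset.smul_sum, mul_smul] }
    (s.card : ℝ) fun f => by
      refine (norm_contLp_le _).trans ?_
      rw [fourierSum, ← nsmul_eq_mul]
      refine norm_sum_le_of_le _ (fun k _ => ?_) |>.trans_eq (Finset.sum_const _)
      rw [norm_smul, fourier_norm, mul_one]
      exact norm_fourierCoeff_le f k

theorem fourierSumCLM_apply (s : Finset ℤ) (f : Lp ℂ p (@haarAddCircle T hT)) :
    fourierSumCLM p s f = contLp p (fourierSum s f) := rfl

theorem fourierSumCLM_contLp (s : Finset ℤ) (f : C(AddCircle T, ℂ)) :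
    fourierSumCLM p s (contLp p f) = contLp p (fourierSum s f) := by
  rw [fourierSumCLM_apply]
  congr 1
  simp only [fourierSum, fourierCoeff_contLp]

/-- **Riesz's theorem**: the partial sums of the Fourier series are uniformly bounded on `L^p` for
`1 < p < ∞`. -/
theorem exists_norm_fourierSumCLM_le (hp1 : 1 < p) (hp : p ≠ ∞) :
    ∃ C : ℝ, 0 ≤ C ∧ ∀ (m : ℕ) (f : Lp ℂ p (@haarAddCircle T hT)),
      ‖fourierSumCLM p (Finset.Icc (-(m : ℤ)) m) f‖ ≤ C * ‖f‖ := by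
  obtain ⟨C, hC0, hC⟩ := exists_norm_fourierSum_le (T := T) hp1 hp
  refine ⟨C, hC0, fun m f => ?_⟩
  refine (ContinuousMap.toLp_denseRange ℂ (@haarAddCircle T hT) ℂ hp).induction_on
    (p := fun f => ‖fourierSumCLM p (Finset.Icc (-(m : ℤ)) m) f‖ ≤ C * ‖f‖) f
    (isClosed_le (by fun_prop) (by fun_prop)) fun g => ?_
  rw [fourierSumCLM_contLp]
  exact hC g m

theorem tendsto_fourierSumCLM (hp1 : 1 < p) (hp : p ≠ ∞) (f : Lp ℂ p (@haarAddCircle T hT)) :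
    Tendsto (fun m : ℕ => fourierSumCLM p (Finset.Icc (-(m : ℤ)) m) f) atTop (𝓝 f) := by
  obtain ⟨C, hC0, hC⟩ := exists_norm_fourierSumCLM_le (T := T) hp1 hp
  rw [Metric.tendsto_atTop']
  intro ε hε
  have hd : f ∈ closure (contLp p '' (Submodule.span ℂ (Set.range (@fourier T)))) := by
    have h := (ContinuousMap.toLp_denseRange ℂ (@haarAddCircle T hT) ℂ hp).dense_image
      (ContinuousLinearMap.continuous _)
      (Submodule.dense_iff_topologicalClosure_eq_top.2 (span_fourier_closure_eq_top (T := T)))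
    exact h f
  have hδ : 0 < ε / (C + 2) := by positivity
  obtain ⟨_, ⟨g, hg, rfl⟩, hfg⟩ := Metric.mem_closure_iff.1 hd _ hδ
  obtain ⟨N, hN⟩ := eventually_atTop.1 (eventually_fourierSum_eq hg)
  refine ⟨N, fun m hm => ?_⟩
  have e : fourierSumCLM p (Finset.Icc (-(m : ℤ)) m) f - f
      = fourierSumCLM p (Finset.Icc (-(m : ℤ)) m) (f - contLp p g) - (f - contLp p g) := by
    rw [map_sub, fourierSumCLM_contLp, hN m hm.le]
    abel
  rw [dist_eq_norm] at hfg
  rw [dist_eq_norm, e]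
  calc _ ≤ C * ‖f - contLp p g‖ + ‖f - contLp p g‖ :=
        (norm_sub_le _ _).trans (by gcongr; exact hC m _)
    _ = (C + 1) * ‖f - contLp p g‖ := by ring
    _ ≤ (C + 1) * (ε / (C + 2)) := by gcongr
    _ < ε := by
      rw [mul_div_assoc', div_lt_iff₀ (by positivity)]
      nlinarith

end NonlinearFourier

namespace NonlinearFourier

/-! ### Composition operators between `L^p` spaces -/

/-- Composition with `φ` is bounded from `L^p(ν)` to `L^p(μ)` if `φ` maps `μ` to a measure at most
`c • ν`. -/
theorem exists_continuousLinearMap_comp {X Y : Type*} [MeasurableSpace X] [MeasurableSpace Y]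
    {μ : Measure X} {ν : Measure Y} {φ : X → Y} (hφ : Measurable φ) {c : ℝ≥0∞} (hc : c ≠ ∞)
    (hle : μ.map φ ≤ c • ν) (p : ℝ≥0∞) [Fact (1 ≤ p)] (hp : p ≠ ∞) :
    ∃ J : Lp ℂ p ν →L[ℂ] Lp ℂ p μ, ∀ f, J f =ᵐ[μ] f ∘ φ := by
  have hac : μ.map φ ≪ ν := Measure.absolutelyContinuous_of_le_smul hle
  have hq : Measure.QuasiMeasurePreserving φ μ ν := ⟨hφ, hac⟩
  have hm : ∀ f : Lp ℂ p ν, AEStronglyMeasurable f (μ.map φ) := fun f =>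
    (Lp.aestronglyMeasurable f).mono_ac hac
  have hn : ∀ f : Lp ℂ p ν,
      eLpNorm (f ∘ φ) p μ ≤ c ^ (1 / p.toReal) * eLpNorm f p ν := fun f => by
    rw [← eLpNorm_map_measure (hm f) hφ.aemeasurable]
    refine (eLpNorm_mono_measure _ hle).trans_eq ?_
    rw [eLpNorm_smul_measure_of_ne_top hp, smul_eq_mul, one_div]
    simp
  have hc' : c ^ (1 / p.toReal) ≠ ∞ := ENNReal.rpow_ne_top_of_nonneg (by positivity) hc
  have hmem : ∀ f : Lp ℂ p ν, MemLp (f ∘ φ) p μ := fun f =>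
    ⟨(hm f).comp_measurable hφ,
      (hn f).trans_lt (ENNReal.mul_lt_top hc'.lt_top (Lp.eLpNorm_lt_top f))⟩
  refine ⟨LinearMap.mkContinuous
    { toFun := fun f => (hmem f).toLp
      map_add' := fun f g => ?_
      map_smul' := fun r f => ?_ } (c ^ (1 / p.toReal)).toReal fun f => ?_, fun f => ?_⟩
  · rw [← MemLp.toLp_add]
    exact MemLp.toLp_congr _ _ (hq.ae_eq (Lp.coeFn_add f g))
  · rw [RingHom.id_apply, ← MemLp.toLp_const_smul]
    exact MemLp.toLp_congr _ _ (hq.ae_eq (Lp.coeFn_smul r f))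
  · change ‖(hmem f).toLp‖ ≤ _
    rw [Lp.norm_toLp, Lp.norm_def, ← ENNReal.toReal_mul]
    exact ENNReal.toReal_mono (ENNReal.mul_ne_top hc' (Lp.eLpNorm_ne_top f)) (hn f)
  · exact (hmem f).coeFn_toLp

/-! ### The phase map of the circle -/

instance fact_two_pi_pos : Fact (0 < 2 * Real.pi) := ⟨Real.two_pi_pos⟩

/-- The phase `θ_a(t)` as a point of the circle `ℝ / 2πℤ`. -/
noncomputable def phaseCircle (a : ℂ) (t : ℝ) : AddCircle (2 * Real.pi) := (phase a t : ℝ)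

/-- The inverse of `phaseCircle a` with values in `(-π, π]`, given by the phase of the inverse
Möbius transformation `τ_{-a}`. -/
noncomputable def phaseCircleInv (a : ℂ) (x : AddCircle (2 * Real.pi)) : ℝ :=
  AddCircle.equivIoc (2 * Real.pi) (-Real.pi)
    (phaseCircle (-a) (AddCircle.equivIoc (2 * Real.pi) (-Real.pi) x))

variable {a : ℂ}

theorem fourier_phaseCircle (k : ℤ) (t : ℝ) :
    fourier k (phaseCircle a t) = Complex.exp (Complex.I * k * phase a t) := by
  rw [phaseCircle, fourier_coe_apply]
  congr 1
  have : (Real.pi : ℂ) ≠ 0 := by exact_mod_cast Real.pi_ne_zero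
  push_cast
  field_simp

theorem toCircle_phaseCircle (ha : ‖a‖ < 1) (t : ℝ) :
    ((phaseCircle a t).toCircle : ℂ) = mobius a (Complex.exp (t * Complex.I)) := by
  rw [← fourier_one, fourier_phaseCircle, ← exp_phase ha]
  simp

theorem mobius_neg_mobius (ha : ‖a‖ < 1) {z : ℂ} (hz : ‖z‖ = 1) : mobius (-a) (mobius a z) = z := by
  have hd : 1 - (starRingEnd ℂ) a * z ≠ 0 := by
    intro h
    have h1 : ‖(starRingEnd ℂ) a * z‖ = 1 := by rw [← sub_eq_zero.1 h, norm_one]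
    rw [norm_mul, RCLike.norm_conj, hz, mul_one] at h1
    exact ha.ne h1
  have hn : 1 - (starRingEnd ℂ) a * a ≠ 0 := by
    intro h
    have h1 : ‖(starRingEnd ℂ) a * a‖ = 1 := by rw [← sub_eq_zero.1 h, norm_one]
    rw [norm_mul, RCLike.norm_conj] at h1
    nlinarith [norm_nonneg a]
  have e : 1 - (starRingEnd ℂ) (-a) * ((z - a) / (1 - (starRingEnd ℂ) a * z))
      = (1 - (starRingEnd ℂ) a * a) / (1 - (starRingEnd ℂ) a * z) := by
    rw [map_neg]
    field_simp
    ring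
  rw [mobius, mobius, e, div_eq_iff (div_ne_zero hn hd), mul_div_assoc', eq_div_iff hd, sub_mul,
    div_mul_cancel₀ _ hd]
  ring

theorem toCircle_coe (t : ℝ) :
    (AddCircle.toCircle (t : AddCircle (2 * Real.pi)) : ℂ) = Complex.exp (t * Complex.I) := by
  rw [← fourier_one, fourier_coe_apply]
  congr 1
  have : (Real.pi : ℂ) ≠ 0 := by exact_mod_cast Real.pi_ne_zero
  push_cast
  field_simp

theorem phaseCircleInv_phaseCircle (ha : ‖a‖ < 1) {t : ℝ}
    (ht : t ∈ Set.Ioc (-Real.pi) Real.pi) : phaseCircleInv a (phaseCircle a t) = t := by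
  have ht' : t ∈ Set.Ioc (-Real.pi) (-Real.pi + 2 * Real.pi) := by
    convert ht using 2; ring
  have key : phaseCircle (-a) (AddCircle.equivIoc (2 * Real.pi) (-Real.pi) (phaseCircle a t))
      = (t : AddCircle (2 * Real.pi)) := by
    apply AddCircle.injective_toCircle (T := 2 * Real.pi) Real.two_pi_pos.ne'
    apply Subtype.ext
    rw [toCircle_phaseCircle (by rwa [norm_neg]), ← toCircle_coe, AddCircle.coe_equivIoc,
      toCircle_phaseCircle ha, toCircle_coe,
      mobius_neg_mobius ha (Complex.norm_exp_ofReal_mul_I t)]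
  rw [phaseCircleInv, key, AddCircle.equivIoc_coe_of_mem ht']

theorem continuous_phase (ha : ‖a‖ < 1) : Continuous (phase a) :=
  continuous_iff_continuousAt.2 fun t => (hasDerivAt_phase ha t).continuousAt

theorem measurable_phaseCircle (ha : ‖a‖ < 1) : Measurable (phaseCircle a) :=
  ((AddCircle.continuous_mk' (2 * Real.pi)).comp (continuous_phase ha)).measurable

theorem measurable_phaseCircleInv (ha : ‖a‖ < 1) : Measurable (phaseCircleInv a) := by
  have h : Measurable fun x : AddCircle (2 * Real.pi) =>
      (AddCircle.equivIoc (2 * Real.pi) (-Real.pi) x : ℝ) :=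
    measurable_subtype_coe.comp (AddCircle.measurableEquivIoc (2 * Real.pi) (-Real.pi)).measurable
  exact h.comp ((measurable_phaseCircle (by rwa [norm_neg])).comp h)

theorem phase_add_two_pi (t : ℝ) : phase a (t + 2 * Real.pi) = phase a t + 2 * Real.pi := by
  have h : Complex.exp (-(((t + 2 * Real.pi : ℝ) : ℂ) * Complex.I))
      = Complex.exp (-(t * Complex.I)) := by
    have e : -(((t + 2 * Real.pi : ℝ) : ℂ) * Complex.I)
        = -(t * Complex.I) - 2 * Real.pi * Complex.I := by push_cast; ring
    rw [e, Complex.exp_sub, Complex.exp_two_pi_mul_I, div_one]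
  rw [phase, phase, h]
  ring

/-! ### The measure with the Poisson kernel as density -/

theorem poisson_denom_pos (ha : ‖a‖ < 1) (t : ℝ) :
    0 < 1 - 2 * ‖a‖ * Real.cos (t - a.arg) + ‖a‖ ^ 2 := by
  nlinarith [Real.cos_le_one (t - a.arg), norm_nonneg a, sq_pos_of_pos (sub_pos.2 ha)]

theorem continuous_poisson (ha : ‖a‖ < 1) : Continuous (poisson a) := by
  unfold poisson
  exact Continuous.div (by fun_prop) (by fun_prop) fun t => (poisson_denom_pos ha t).ne'

theorem poisson_le (ha : ‖a‖ < 1) (t : ℝ) : poisson a t ≤ (1 + ‖a‖) / (1 - ‖a‖) := by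
  rw [poisson, div_le_div_iff₀ (poisson_denom_pos ha t) (by linarith)]
  have h : 0 ≤ 2 * ‖a‖ * (1 - Real.cos (t - a.arg)) :=
    mul_nonneg (by positivity) (by linarith [Real.cos_le_one (t - a.arg)])
  nlinarith [mul_nonneg h (by positivity : 0 ≤ 1 + ‖a‖)]

theorem one_le_mul_poisson (ha : ‖a‖ < 1) (t : ℝ) :
    1 ≤ (1 + ‖a‖) / (1 - ‖a‖) * poisson a t := by
  have h1 : 0 < 1 - ‖a‖ := by linarith
  rw [poisson, div_mul_div_comm, le_div_iff₀ (mul_pos h1 (poisson_denom_pos ha t)), one_mul]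
  have h : 0 ≤ 2 * ‖a‖ * (1 + Real.cos (t - a.arg)) :=
    mul_nonneg (by positivity) (by linarith [Real.neg_one_le_cos (t - a.arg)])
  nlinarith [mul_nonneg h h1.le]

theorem poisson_nonneg (ha : ‖a‖ < 1) (t : ℝ) : 0 ≤ poisson a t :=
  div_nonneg (by nlinarith [norm_nonneg a]) (poisson_denom_pos ha t).le

/-- The measure `p_a(t) dt / (2π)` on `(-π, π]`. -/
noncomputable def phaseMeasure (a : ℂ) : Measure ℝ :=
  circleMeasure.withDensity fun t => ENNReal.ofReal (poisson a t)

instance isFiniteMeasure_circleMeasure : IsFiniteMeasure circleMeasure := by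
  unfold circleMeasure
  exact Measure.smul_finite _ ENNReal.ofReal_ne_top

theorem phaseMeasure_le (ha : ‖a‖ < 1) :
    phaseMeasure a ≤ ENNReal.ofReal ((1 + ‖a‖) / (1 - ‖a‖)) • circleMeasure := by
  rw [phaseMeasure, ← withDensity_const]
  exact withDensity_mono (Eventually.of_forall fun t => ENNReal.ofReal_le_ofReal (poisson_le ha t))

theorem circleMeasure_le (ha : ‖a‖ < 1) :
    circleMeasure ≤ ENNReal.ofReal ((1 + ‖a‖) / (1 - ‖a‖)) • phaseMeasure a := by
  rw [phaseMeasure, ← withDensity_smul _ (continuous_poisson ha).measurable.ennreal_ofReal]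
  conv_lhs => rw [← withDensity_one (μ := circleMeasure)]
  refine withDensity_mono (Eventually.of_forall fun t => ?_)
  have h0 : 0 ≤ (1 + ‖a‖) / (1 - ‖a‖) := div_nonneg (by positivity) (by linarith)
  simp only [Pi.smul_apply, Pi.one_apply, smul_eq_mul]
  rw [← ENNReal.ofReal_mul h0, ENNReal.one_le_ofReal]
  exact one_le_mul_poisson ha t

theorem isFiniteMeasure_phaseMeasure (ha : ‖a‖ < 1) : IsFiniteMeasure (phaseMeasure a) := by
  have := Measure.smul_finite circleMeasure
    (ENNReal.ofReal_ne_top (r := (1 + ‖a‖) / (1 - ‖a‖)))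
  exact isFiniteMeasure_of_le _ (phaseMeasure_le ha)

theorem integral_phaseMeasure {E : Type*} [NormedAddCommGroup E] [NormedSpace ℝ E] (ha : ‖a‖ < 1)
    (g : ℝ → E) :
    ∫ t, g t ∂phaseMeasure a
      = (1 / (2 * Real.pi)) • ∫ t in (-Real.pi)..Real.pi, poisson a t • g t := by
  have hpi := Real.pi_pos
  rw [phaseMeasure, integral_withDensity_eq_integral_toReal_smul
    (continuous_poisson ha).measurable.ennreal_ofReal
    (Eventually.of_forall fun t => ENNReal.ofReal_lt_top), circleMeasure, integral_smul_measure,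
    ENNReal.toReal_ofReal (by positivity), intervalIntegral.integral_of_le (by linarith)]
  simp only [ENNReal.toReal_ofReal (poisson_nonneg ha _)]

/-- The substitution `s = θ_a(t)`, `ds = p_a(t) dt`, as an identity of measures. -/
theorem map_phaseCircle (ha : ‖a‖ < 1) :
    (phaseMeasure a).map (phaseCircle a) = AddCircle.haarAddCircle := by
  have := isFiniteMeasure_phaseMeasure ha
  have := Measure.isFiniteMeasure_map (phaseMeasure a) (phaseCircle a)
  refine ext_of_forall_integral_eq_of_IsFiniteMeasure fun f => ?_
  have hcont : Continuous fun s : ℝ => f (s : AddCircle (2 * Real.pi)) :=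
    f.continuous.comp (AddCircle.continuous_mk' _)
  rw [integral_map (measurable_phaseCircle ha).aemeasurable
    f.continuous.aestronglyMeasurable, integral_phaseMeasure ha,
    AddCircle.integral_haarAddCircle, one_div]
  congr 1
  have h := intervalIntegral.integral_deriv_smul_comp (a := -Real.pi) (b := Real.pi)
    (fun t _ => hasDerivAt_phase ha t) (continuous_poisson ha).continuousOn hcont
  have e : phase a Real.pi = phase a (-Real.pi) + 2 * Real.pi := by
    rw [← phase_add_two_pi]; congr 1; ring
  rw [e, AddCircle.intervalIntegral_preimage (2 * Real.pi) (phase a (-Real.pi)) f] at h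
  exact h

theorem ae_phaseCircleInv_phaseCircle (ha : ‖a‖ < 1) :
    ∀ᵐ t ∂circleMeasure, phaseCircleInv a (phaseCircle a t) = t := by
  refine Measure.ae_smul_measure ?_ _
  filter_upwards [ae_restrict_mem measurableSet_Ioc] with t ht
  exact phaseCircleInv_phaseCircle ha ht

theorem phaseMeasure_absolutelyContinuous : phaseMeasure a ≪ circleMeasure :=
  withDensity_absolutelyContinuous _ _

theorem map_phaseCircleInv (ha : ‖a‖ < 1) :
    Measure.map (phaseCircleInv a) AddCircle.haarAddCircle = phaseMeasure a := by
  rw [← map_phaseCircle ha, Measure.map_map (measurable_phaseCircleInv ha)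
    (measurable_phaseCircle ha)]
  conv_rhs => rw [← Measure.map_id (μ := phaseMeasure a)]
  exact Measure.map_congr
    (phaseMeasure_absolutelyContinuous.ae_le (ae_phaseCircleInv_phaseCircle ha))

/-- The nonlinear Fourier coefficients of `f` are the Fourier coefficients of `f ∘ θ_a⁻¹`. -/
theorem fourierCoeff_comp_phaseCircleInv (ha : ‖a‖ < 1) {f : ℝ → ℂ}
    (hf : AEStronglyMeasurable f circleMeasure) (k : ℤ) :
    fourierCoeff (f ∘ phaseCircleInv a) k = coeff a f k := by
  have hmeas : AEStronglyMeasurable (f ∘ phaseCircleInv a) AddCircle.haarAddCircle := by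
    refine AEStronglyMeasurable.comp_measurable ?_ (measurable_phaseCircleInv ha)
    rw [map_phaseCircleInv ha]
    exact hf.mono_ac phaseMeasure_absolutelyContinuous
  have hmeas' : AEStronglyMeasurable
      (fun x => fourier (-k) x • (f ∘ phaseCircleInv a) x)
      (Measure.map (phaseCircle a) (phaseMeasure a)) := by
    rw [map_phaseCircle ha]
    exact (map_continuous (fourier (-k))).aestronglyMeasurable.smul hmeas
  rw [fourierCoeff, ← map_phaseCircle ha,
    integral_map (measurable_phaseCircle ha).aemeasurable hmeas']
  have h : ∀ᵐ t ∂phaseMeasure a,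
      fourier (-k) (phaseCircle a t) • (f ∘ phaseCircleInv a) (phaseCircle a t)
        = f t * Complex.exp (-(Complex.I * k * phase a t)) := by
    filter_upwards [phaseMeasure_absolutelyContinuous.ae_le
      (ae_phaseCircleInv_phaseCircle ha)] with t ht
    rw [Function.comp_apply, ht, fourier_phaseCircle, smul_eq_mul, mul_comm]
    push_cast
    ring_nf
  rw [integral_congr_ae h, integral_phaseMeasure ha, coeff, Complex.real_smul]
  congr 1
  · push_cast; rfl
  · refine intervalIntegral.integral_congr fun t _ => ?_
    simp only [Complex.real_smul]
    ring

end NonlinearFourier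

open NonlinearFourier in
theorem corollary2p1 (a : ℂ) (ha : ‖a‖ < 1) (p : ℝ≥0∞) [Fact (1 ≤ p)]
    (hp1 : 1 < p) (hp : p < ∞) :
    ∃ S : ℕ → (Lp ℂ p NonlinearFourier.circleMeasure →L[ℂ] Lp ℂ p NonlinearFourier.circleMeasure),
      (∀ (n : ℕ) (f : Lp ℂ p NonlinearFourier.circleMeasure),
        S n f =ᵐ[NonlinearFourier.circleMeasure] NonlinearFourier.partialSum a n f) ∧
      (∃ M : ℝ, 0 < M ∧ ∀ n : ℕ, ‖S n‖ ≤ M) ∧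
      (∀ f : Lp ℂ p NonlinearFourier.circleMeasure,
        Tendsto (fun n : ℕ => ‖f - S n f‖) atTop (𝓝 0)) := by
  -- `J` is composition with the inverse phase, `I` composition with the phase
  obtain ⟨J, hJ⟩ := exists_continuousLinearMap_comp (measurable_phaseCircleInv ha)
    (ENNReal.ofReal_ne_top (r := (1 + ‖a‖) / (1 - ‖a‖)))
    ((map_phaseCircleInv ha).trans_le (phaseMeasure_le ha)) p hp.ne
  have hle : circleMeasure.map (phaseCircle a)
      ≤ ENNReal.ofReal ((1 + ‖a‖) / (1 - ‖a‖)) • AddCircle.haarAddCircle := by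
    rw [← map_phaseCircle ha, ← Measure.map_smul]
    exact Measure.map_mono (circleMeasure_le ha) (measurable_phaseCircle ha)
  have hq : Measure.QuasiMeasurePreserving (phaseCircle a) circleMeasure
      AddCircle.haarAddCircle :=
    ⟨measurable_phaseCircle ha, Measure.absolutelyContinuous_of_le_smul hle⟩
  obtain ⟨I, hI⟩ := exists_continuousLinearMap_comp (measurable_phaseCircle ha)
    ENNReal.ofReal_ne_top hle p hp.ne
  have hIJ : ∀ f, I (J f) = f := by
    intro f
    refine Lp.ext ?_
    filter_upwards [hI (J f), hq.ae_eq_comp (hJ f), ae_phaseCircleInv_phaseCircle ha] with t h1 h2 h3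
    rw [h1, h2]
    simp only [Function.comp_apply, h3]
  obtain ⟨C, hC0, hC⟩ := exists_norm_fourierSumCLM_le (T := 2 * Real.pi) hp1 hp.ne
  refine ⟨fun n => I ∘L fourierSumCLM p (Finset.Icc (-(n : ℤ)) n) ∘L J, fun n f => ?_,
    ⟨‖I‖ * (C * ‖J‖) + 1, by positivity, fun n => ?_⟩, fun f => ?_⟩
  · have h1 := hq.ae_eq_comp (ContinuousMap.coeFn_toLp (p := p) (𝕜 := ℂ) AddCircle.haarAddCircle
      (fourierSum (Finset.Icc (-(n : ℤ)) n) (J f)))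
    filter_upwards [hI (fourierSumCLM p (Finset.Icc (-(n : ℤ)) n) (J f)), h1] with t h2 h3
    rw [ContinuousLinearMap.comp_apply, ContinuousLinearMap.comp_apply, h2, fourierSumCLM_apply, h3,
      Function.comp_apply, fourierSum_apply, partialSum]
    refine Finset.sum_congr rfl fun k _ => ?_
    rw [fourier_phaseCircle, fourierCoeff_congr_ae (hJ f),
      fourierCoeff_comp_phaseCircleInv ha (Lp.aestronglyMeasurable f)]
  · have h1 : ‖fourierSumCLM (T := 2 * Real.pi) p (Finset.Icc (-(n : ℤ)) n)‖ ≤ C :=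
      ContinuousLinearMap.opNorm_le_bound _ hC0 (hC n)
    have h2 : ‖I ∘L fourierSumCLM p (Finset.Icc (-(n : ℤ)) n) ∘L J‖ ≤ ‖I‖ * (C * ‖J‖) :=
      (ContinuousLinearMap.opNorm_comp_le _ _).trans (by
        gcongr
        exact (ContinuousLinearMap.opNorm_comp_le _ _).trans (by gcongr))
    exact h2.trans (le_add_of_nonneg_right zero_le_one)
  · have h1 := (I.continuous.tendsto _).comp (tendsto_fourierSumCLM hp1 hp.ne (J f))
    rw [hIJ] at h1
    have h2 := (tendsto_const_nhds (x := f)).sub h1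
    rw [sub_self] at h2
    simpa using h2.norm
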